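/- **Theorem.** A set $Z\subseteq\mathbb N$ is *dense simple* if it is recursively enumerable (r.e.), has infinite complement, and the enumeration $a_0<a_1<\cdots$ of $\mathbb N\setminus Z$ dominates every recursive function $f$, i.e. $f(n)<a_n$ for all but finitely many $n$. Let $Z$ be any dense simple set with $0\notin Z$, and put $x\,\zeta\,y$ iff there is an $n$ with $a_n\le\min\{x,y\}\le\max\{x,y\}<a_{n+1}$. Then $\zeta$ is a positive (i.e. r.e.) equivalence relation on $\mathbb N$ with infinitely many classes, and 1. there is a confidently learnable $\zeta$-family; 2. no $\zeta$-family is finitely learnable. Here a *$\zeta$-family* is a sequence $B_0,B_1,\ldots$ of pairwise distinct sets, each a union of $\zeta$-classes, with $\{(k,x):x\in B_k\}$ r.e. A *text* is a map $T:\mathbb N\to\mathbb N\cup\{\#\}$; it is a text for $L\subseteq\mathbb N$ if the set of numbers occurring in $T$ is $L$; $T[n]$ denotes $T(0),\ldots,T(n-1)$. A *learner* is a recursive function $M:(\mathbb N\cup\{\#\})^*\to\mathbb N\cup\{?\}$. Let $W_0,W_1,\ldots$ be a fixed acceptable numbering of all r.e. sets and let $H_e$ be the $\zeta$-closure of $W_e$,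 i.e. the union of all $\zeta$-classes meeting $W_e$. The family $B_0,B_1,\ldots$ is - *confidently learnable* if some learner $M$ satisfies: for every $k$ and every text $T$ for $B_k$, there are $n,e\in\mathbb N$ with $H_e=B_k$ and $M(T[j])=e$ for all $j\ge n$; and for every text $T$ whatsoever there are $n,e\in\mathbb N$ with $M(T[j])=e$ for all $j\ge n$; - *finitely learnable* if some learner $M$ satisfies: for every $k$ and every text $T$ for $B_k$, there are $n,e\in\mathbb N$ with $H_e=B_k$, $M(T[m])={?}$ for all $m<n$, and $M(T[j])=e$ for all $j\ge n$. -/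

import Mathlib

namespace EtaLearning

/-- The `e`-th recursively enumerable set `W_e`: the domain of the `e`-th partial recursive
function in the acceptable numbering of partial recursive functions given by Mathlib's codes. -/
def W (e : ℕ) : Set ℕ :=
  {x | (Nat.Partrec.Code.eval (Denumerable.ofNat Nat.Partrec.Code e) x).Dom}

/-! ### Positive equivalence relations and families of closed sets -/

/-- A positive (that is, r.e.) equivalence relation on `ℕ` with infinitely many classes. -/
structure IsPositive (η : ℕ → ℕ → Prop) : Prop where
  equivalence : Equivalence η
  re : REPred (fun p : ℕ × ℕ => η p.1 p.2)
  infinite_classes : (Set.range fun x : ℕ => {y : ℕ | η x y}).Infinite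

/-- `L` is a union of `η`-equivalence classes. -/
def IsClosedUnder (η : ℕ → ℕ → Prop) (L : Set ℕ) : Prop :=
  ∀ x y, η x y → x ∈ L → y ∈ L

/-- The `η`-closure `[D]` of a set `D`. -/
def closureUnder (η : ℕ → ℕ → Prop) (D : Set ℕ) : Set ℕ :=
  {y | ∃ x ∈ D, η x y}

/-- An `η`-family: a one-one uniformly r.e. numbering `B 0, B 1, …` of unions of
`η`-equivalence classes. -/
structure IsFamily (η : ℕ → ℕ → Prop) (B : ℕ → Set ℕ) : Prop where
  injective : Function.Injective B
  uniformly_re : REPred (fun p : ℕ × ℕ => p.2 ∈ B p.1)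
  closed : ∀ k, IsClosedUnder η (B k)

/-! ### Texts, learners and learning criteria

The pause symbol `#` and the abstention symbol `?` are both represented by `none`. -/

/-- The content of a text: the numbers which occur in it. -/
def content (T : ℕ → Option ℕ) : Set ℕ := {x | ∃ n, T n = some x}

/-- The initial segment `T[n] = T(0), …, T(n-1)`. -/
def initSeg (T : ℕ → Option ℕ) (n : ℕ) : List (Option ℕ) := (List.range n).map T

/-- A learner `M` explanatorily learns the class `C` in the hypothesis space `H`. -/
def ExLearns (H : ℕ → Set ℕ) (M : List (Option ℕ) → Option ℕ) (C : Set (Set ℕ)) : Prop :=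
  ∀ L ∈ C, ∀ T : ℕ → Option ℕ, content T = L →
    ∃ n e, H e = L ∧ ∀ j, n ≤ j → M (initSeg T j) = some e

/-- `M` confidently learns `C`: it learns `C` explanatorily, and on every text whatsoever it
converges to some index. -/
def ConfLearns (H : ℕ → Set ℕ) (M : List (Option ℕ) → Option ℕ) (C : Set (Set ℕ)) : Prop :=
  ExLearns H M C ∧
    ∀ T : ℕ → Option ℕ, ∃ n e, ∀ j, n ≤ j → M (initSeg T j) = some e

/-- `M` finitely learns `C`: on every text for a member of `C`, it abstains up to some point, and
from then on always issues one and the same correct index. -/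
def FinLearns (H : ℕ → Set ℕ) (M : List (Option ℕ) → Option ℕ) (C : Set (Set ℕ)) : Prop :=
  ∀ L ∈ C, ∀ T : ℕ → Option ℕ, content T = L →
    ∃ n e, H e = L ∧ (∀ m, m < n → M (initSeg T m) = none) ∧
      ∀ j, n ≤ j → M (initSeg T j) = some e

/-- The hypothesis space for `η`: the `η`-closures of `W_0, W_1, …`. -/
def hypSpace (η : ℕ → ℕ → Prop) (e : ℕ) : Set ℕ := closureUnder η (W e)

/-- Some recursive learner confidently learns `C`. -/
def ConfLearnable (η : ℕ → ℕ → Prop) (C : Set (Set ℕ)) : Prop :=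
  ∃ M : List (Option ℕ) → Option ℕ, Computable M ∧ ConfLearns (hypSpace η) M C

/-- Some recursive learner finitely learns `C`. -/
def FinLearnable (η : ℕ → ℕ → Prop) (C : Set (Set ℕ)) : Prop :=
  ∃ M : List (Option ℕ) → Option ℕ, Computable M ∧ FinLearns (hypSpace η) M C

/-! ### Dense simple sets and the relation `ζ` -/

/-- The `n`-th non-element `a_n` of `Z` in ascending order, starting with `a_0`
(meaningful for all `n` when `Z` is coinfinite). -/
noncomputable def nonElement (Z : Set ℕ) (n : ℕ) : ℕ := Nat.nth (fun x => x ∉ Z) n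

/-- `Z` is dense simple: r.e., coinfinite, and the ascending enumeration of its complement
dominates every recursive function. -/
structure IsDenseSimple (Z : Set ℕ) : Prop where
  re : REPred (fun x : ℕ => x ∈ Z)
  coinfinite : Zᶜ.Infinite
  dominates : ∀ f : ℕ → ℕ, Computable f → ∃ N, ∀ n, N ≤ n → f n < nonElement Z n

/-- `x ζ y` iff `a_n ≤ min {x, y} ≤ max {x, y} < a_{n+1}` for some `n`. -/
def zeta (Z : Set ℕ) (x y : ℕ) : Prop :=
  ∃ n, nonElement Z n ≤ min x y ∧ max x y < nonElement Z (n + 1)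

end EtaLearning

/-!
Let `rank Z x` be the number of non-elements of `Z` up to `x`. The classes of `ζ` are the level
sets of `rank Z`, and along an enumeration of `Z` the ranks are computed from above, while two
numbers which were once found to be equivalent stay so.

For the confident learner, `B k` is the interval from the class of `k` to the class of `a_k`. The
position `k` can be read off from the maximum of `B k`, and `k` lies in the class of the minimum.
A learner which withdraws its guess when it lies above the class of some number seen
so far converges on texts with infinite content too: there the maximum of the numbers seen, hence
the guess, exceeds any bound.

A finite learner commits itself on a finite part `D k` of `B k`, and `D k ⊆ B j` only for `j = k`.
A computable function `f` can bound the elements of `D 0, …, D (2 ^ n)` in terms of `n`. If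
`f n < a_n`, then these `2 ^ n + 1` sets meet only the first `n` classes, so that two of them,
`D j` and `D k`, meet the same classes. Then `D k ⊆ B j` as `B j` is closed under `ζ`, a
contradiction.
-/

namespace EtaLearning

open Filter

/-! ### Enumerations of r.e. sets -/

open Nat.Partrec (Code)

theorem exists_code_dom {α : Type*} [Primcodable α] {p : α → Prop} (hp : REPred p) :
    ∃ c : Code, ∀ a, p a ↔ (c.eval (Encodable.encode a)).Dom := by
  obtain ⟨c, hc⟩ := Code.exists_code.1 hp
  refine ⟨c, fun a => ?_⟩
  rw [hc]
  simp [Part.assert]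

theorem exists_primrec_stages {α : Type*} [Primcodable α] {A : Set α}
    (hA : REPred fun a => a ∈ A) :
    ∃ S : ℕ → Set α, PrimrecRel (fun s a => a ∈ S s) ∧ Monotone S ∧ ⋃ s, S s = A := by
  obtain ⟨c, hc⟩ := exists_code_dom hA
  refine ⟨fun s => {a | (c.evaln s (Encodable.encode a)).isSome = true}, ?_, ?_, ?_⟩
  · have h : Primrec fun q : ℕ × α => (c.evaln q.1 (Encodable.encode q.2)).isSome :=
      Primrec.option_isSome.comp (Code.primrec_evaln.comp
        ((Primrec.fst.pair (Primrec.const c)).pair (Primrec.encode.comp Primrec.snd)))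
    exact ⟨fun _ => inferInstanceAs (Decidable (_ = true)), by simpa using h⟩
  · intro s t hst a ha
    obtain ⟨v, hv⟩ := Option.isSome_iff_exists.1 (show _ = true from ha)
    exact Option.isSome_iff_exists.2 ⟨v, Code.evaln_mono hst hv⟩
  · ext a
    simp only [hc, Part.dom_iff_mem, Code.evaln_complete, Set.mem_iUnion, Set.mem_ofPred_eq,
      Option.isSome_iff_exists, Option.mem_def]
    exact exists_comm

theorem rePred_and {α : Type*} [Primcodable α] {p q : α → Prop} (hp : REPred p)
    (hq : REPred q) : REPred fun a => p a ∧ q a := by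
  refine (Partrec.bind hp (hq.comp Computable.fst).to₂).dom_re.of_eq fun a => ?_
  simp [Part.assert, Part.bind]

theorem rePred_comp {α β : Type*} [Primcodable α] [Primcodable β] {p : β → Prop}
    (hp : REPred p) {f : α → β} (hf : Computable f) : REPred fun a => p (f a) :=
  Partrec.comp hp hf

theorem rePred_exists {α : Type*} [Primcodable α] {R : α → ℕ → Prop} (hR : PrimrecRel R) :
    REPred fun a => ∃ s, R a s := by
  classical
  have h := Partrec.rfind (PrimrecPred.computablePred hR).decide.to₂.partrec₂
  refine h.dom_re.of_eq fun a => Nat.rfind_dom.trans ?_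
  simp

/-! ### Ranks and the relation `ζ` -/

open Classical in
/-- The number of elements outside `A` which are at most `x`. For `A = Z`, this is `n + 1` on the
class of `a_n`. -/
noncomputable def rank (A : Set ℕ) (x : ℕ) : ℕ := Nat.count (fun y => y ∉ A) (x + 1)

theorem rank_anti {A B : Set ℕ} (h : A ⊆ B) (x : ℕ) : rank B x ≤ rank A x := by
  classical exact Nat.count_mono_left fun _ _ hk hA => hk (h hA)

theorem rank_le (A : Set ℕ) (x : ℕ) : rank A x ≤ x + 1 := by
  classical exact Nat.count_le _

theorem rank_pos {A : Set ℕ} (h0 : 0 ∉ A) (x : ℕ) : 0 < rank A x := by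
  classical exact Nat.pos_of_ne_zero (Nat.count_ne_iff_exists.2 ⟨0, x.succ_pos, h0⟩)

theorem rank_le_rank_of_subset {A B : Set ℕ} (h : A ⊆ B) {x y : ℕ} (hxy : rank A x ≤ rank A y) :
    rank B x ≤ rank B y := by
  classical
  by_contra! hlt
  obtain ⟨z, ⟨hyz, hzx⟩, hzB⟩ := Nat.exists_of_count_lt_count hlt
  have hzA : z ∉ A := fun hz => hzB (h hz)
  have hy : rank A y ≤ Nat.count (fun y => y ∉ A) z := Nat.count_monotone _ hyz
  have hx : Nat.count (fun y => y ∉ A) z < rank A x := Nat.count_strict_mono hzA hzx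
  exact (hy.trans_lt hx).not_ge hxy

theorem lt_rank_iff {Z : Set ℕ} (hZ : Zᶜ.Infinite) {n x : ℕ} :
    n < rank Z x ↔ nonElement Z n ≤ x := by
  classical exact (Nat.lt_nth_iff_count_lt (p := fun y => y ∉ Z) hZ).trans Nat.lt_succ_iff

theorem rank_nonElement {Z : Set ℕ} (hZ : Zᶜ.Infinite) (n : ℕ) :
    rank Z (nonElement Z n) = n + 1 := by
  classical exact Nat.count_nth_succ_of_infinite hZ n

theorem zeta_iff_rank_eq {Z : Set ℕ} (hZ : Zᶜ.Infinite) (h0 : 0 ∉ Z) {x y : ℕ} :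
    zeta Z x y ↔ rank Z x = rank Z y := by
  have class_iff : ∀ n, (nonElement Z n ≤ min x y ∧ max x y < nonElement Z (n + 1)) ↔
      rank Z x = n + 1 ∧ rank Z y = n + 1 := fun n => by
    rw [le_min_iff, max_lt_iff, ← not_le, ← not_le, ← lt_rank_iff hZ, ← lt_rank_iff hZ,
      ← lt_rank_iff hZ, ← lt_rank_iff hZ]
    omega
  simp only [zeta, class_iff]
  have := rank_pos h0 x
  exact ⟨fun ⟨n, h⟩ => h.1.trans h.2.symm, fun h => ⟨rank Z x - 1, by omega, by omega⟩⟩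

theorem eventually_rank_eq {S : ℕ → Set ℕ} (hS : Monotone S) (x : ℕ) :
    ∀ᶠ s in atTop, rank (S s) x = rank (⋃ s, S s) x := by
  have h : ∀ᶠ s in atTop, ∀ y ∈ Finset.range (x + 1), (y ∈ S s ↔ y ∈ ⋃ s, S s) := by
    refine (eventually_all_finset _).2 fun y _ => ?_
    by_cases hy : y ∈ ⋃ s, S s
    · obtain ⟨s, hs⟩ := Set.mem_iUnion.1 hy
      filter_upwards [eventually_ge_atTop s] with t ht
      exact iff_of_true (hS ht hs) hy
    · exact Eventually.of_forall fun s =>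
        iff_of_false (fun hs => hy (Set.mem_iUnion_of_mem s hs)) hy
  filter_upwards [h] with s hs
  classical
  simp only [rank, Nat.count_eq_card_filter_range]
  exact congrArg Finset.card (Finset.filter_congr fun y hy => not_congr (hs y hy))

theorem primrec_rank {S : ℕ → Set ℕ} (hS : PrimrecRel fun s x => x ∈ S s) :
    Primrec₂ fun s x => rank (S s) x := by
  classical
  have hR : PrimrecRel fun x s => x ∉ S s := hS.not.comp Primrec.snd Primrec.fst
  have h : Primrec₂ fun s x => ((List.range (x + 1)).filter fun y => y ∉ S s).length :=
    Primrec.list_length.comp ((PrimrecRel.listFilter hR).comp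
      (Primrec.list_range.comp (Primrec.succ.comp Primrec.snd)) Primrec.fst)
  refine h.of_eq fun s x => ?_
  simp only [rank, Nat.count, List.countP_eq_length_filter]

theorem rePred_rank_le_rank {Z : Set ℕ} (hZ : REPred fun x => x ∈ Z) :
    REPred fun p : ℕ × ℕ => rank Z p.1 ≤ rank Z p.2 := by
  obtain ⟨S, hSp, hS, rfl⟩ := exists_primrec_stages hZ
  have hr := primrec_rank hSp
  have hR : PrimrecRel fun (p : ℕ × ℕ) s => rank (S s) p.1 ≤ rank (S s) p.2 :=
    Primrec.nat_le.comp (hr.comp Primrec.snd (Primrec.fst.comp Primrec.fst))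
      (hr.comp Primrec.snd (Primrec.snd.comp Primrec.fst))
  refine (rePred_exists hR).of_eq fun p => ⟨?_, fun h => ?_⟩
  · rintro ⟨s, hs⟩
    exact rank_le_rank_of_subset (Set.subset_iUnion S s) hs
  · obtain ⟨s, h1, h2⟩ := ((eventually_rank_eq hS p.1).and (eventually_rank_eq hS p.2)).exists
    exact ⟨s, by rwa [h1, h2]⟩

theorem rePred_rank_le {Z : Set ℕ} (hZ : REPred fun x => x ∈ Z) :
    REPred fun p : ℕ × ℕ => rank Z p.1 ≤ p.2 := by
  obtain ⟨S, hSp, hS, rfl⟩ := exists_primrec_stages hZ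
  have hR : PrimrecRel fun (p : ℕ × ℕ) s => rank (S s) p.1 ≤ p.2 :=
    Primrec.nat_le.comp ((primrec_rank hSp).comp Primrec.snd (Primrec.fst.comp Primrec.fst))
      (Primrec.snd.comp Primrec.fst)
  refine (rePred_exists hR).of_eq fun p => ⟨?_, fun h => ?_⟩
  · rintro ⟨s, hs⟩
    exact (rank_anti (Set.subset_iUnion S s) _).trans hs
  · obtain ⟨s, hs⟩ := (eventually_rank_eq hS p.1).exists
    exact ⟨s, by rwa [hs]⟩

theorem isPositive_zeta {Z : Set ℕ} (hre : REPred fun x => x ∈ Z) (hZ : Zᶜ.Infinite)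
    (h0 : 0 ∉ Z) : IsPositive (zeta Z) := by
  have hiff : ∀ {x y}, zeta Z x y ↔ rank Z x = rank Z y := zeta_iff_rank_eq hZ h0
  refine ⟨⟨fun _ => hiff.2 rfl, fun h => hiff.2 (hiff.1 h).symm,
    fun h h' => hiff.2 ((hiff.1 h).trans (hiff.1 h'))⟩, ?_, ?_⟩
  · have hle := rePred_rank_le_rank hre
    have hge := rePred_comp hle (Computable.snd.pair Computable.fst)
    exact (rePred_and hle hge).of_eq fun p => le_antisymm_iff.symm.trans hiff.symm
  · refine Set.infinite_of_injective_forall_mem (f := fun n => {y | zeta Z (nonElement Z n) y})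
      (fun m n h => ?_) fun n => ⟨_, rfl⟩
    have hmem : zeta Z (nonElement Z m) (nonElement Z n) := (Set.ext_iff.1 h _).2 (hiff.2 rfl)
    rw [hiff, rank_nonElement hZ, rank_nonElement hZ] at hmem
    exact Nat.succ_injective hmem

/-! ### The family of intervals -/

/-- The `k`-th member of the confidently learnable family: if `a_n ≤ k < a_{n+1}`, this is the
interval of all `y` with `a_n ≤ y < a_{k+1}`. -/
def intervalFamily (Z : Set ℕ) (k : ℕ) : Set ℕ := {y | rank Z k ≤ rank Z y ∧ rank Z y ≤ k + 1}

theorem nonElement_mem_intervalFamily {Z : Set ℕ} (hZ : Zᶜ.Infinite) (k : ℕ) :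
    nonElement Z k ∈ intervalFamily Z k :=
  ⟨(rank_le Z k).trans (rank_nonElement hZ k).ge, (rank_nonElement hZ k).le⟩

theorem intervalFamily_finite {Z : Set ℕ} (hZ : Zᶜ.Infinite) (k : ℕ) :
    (intervalFamily Z k).Finite :=
  (Set.finite_lt_nat (nonElement Z (k + 1))).subset fun _ hy =>
    not_le.1 fun hle => ((lt_rank_iff hZ).2 hle).not_ge hy.2

theorem isFamily_intervalFamily {Z : Set ℕ} (hre : REPred fun x => x ∈ Z) (hZ : Zᶜ.Infinite)
    (h0 : 0 ∉ Z) : IsFamily (zeta Z) (intervalFamily Z) where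
  injective := by
    have le_of_eq : ∀ j k, intervalFamily Z j = intervalFamily Z k → k ≤ j := fun j k h => by
      have hmem : nonElement Z k ∈ intervalFamily Z j := h ▸ nonElement_mem_intervalFamily hZ k
      exact Nat.succ_le_succ_iff.1 ((rank_nonElement hZ k).ge.trans hmem.2)
    exact fun j k h => le_antisymm (le_of_eq k j h.symm) (le_of_eq j k h)
  uniformly_re :=
    rePred_and (rePred_rank_le_rank hre) (rePred_comp (rePred_rank_le hre)
      (Computable.snd.pair (Computable.succ.comp Computable.fst)))
  closed k x y hxy hx := by
    have h := (zeta_iff_rank_eq hZ h0).1 hxy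
    simpa only [intervalFamily, Set.mem_ofPred_eq, h] using hx

theorem closureUnder_eq_self {η : ℕ → ℕ → Prop} (hη : ∀ x, η x x) {L : Set ℕ}
    (hL : IsClosedUnder η L) : closureUnder η L = L :=
  Set.Subset.antisymm (fun y ⟨x, hx, hxy⟩ => hL x y hxy hx) fun y hy => ⟨y, hy, hη y⟩

theorem IsFamily.exists_primrec_index {η : ℕ → ℕ → Prop} (hη : ∀ x, η x x) {B : ℕ → Set ℕ}
    (hB : IsFamily η B) : ∃ e : ℕ → ℕ, Primrec e ∧ ∀ k, hypSpace η (e k) = B k := by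
  obtain ⟨c, hc⟩ := exists_code_dom hB.uniformly_re
  refine ⟨fun k => Encodable.encode (c.curry k), Primrec.encode.comp
    (Code.primrec₂_curry.comp (Primrec.const c) Primrec.id), fun k => ?_⟩
  have hW : W (Encodable.encode (c.curry k)) = B k := by
    ext x
    rw [W, Set.mem_ofPred_eq, Denumerable.ofNat_encode, Code.eval_curry]
    exact (hc (k, x)).symm
  rw [hypSpace, hW, closureUnder_eq_self hη (hB.closed k)]

/-! ### Initial segments of texts -/

/-- The content of a finite sequence: the numbers which occur in it. -/
def seen (σ : List (Option ℕ)) : Finset ℕ := σ.reduceOption.toFinset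

theorem mem_seen_initSeg {T : ℕ → Option ℕ} {n x : ℕ} :
    x ∈ seen (initSeg T n) ↔ ∃ i < n, T i = some x := by
  simp [seen, initSeg, List.reduceOption_mem_iff]

theorem seen_initSeg_subset (T : ℕ → Option ℕ) (n : ℕ) :
    ↑(seen (initSeg T n)) ⊆ content T := fun _ hx =>
  let ⟨i, _, hi⟩ := mem_seen_initSeg.1 hx
  ⟨i, hi⟩

theorem eventually_mem_seen {T : ℕ → Option ℕ} {x : ℕ} (hx : x ∈ content T) :
    ∀ᶠ n in atTop, x ∈ seen (initSeg T n) := by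
  obtain ⟨i, hi⟩ := hx
  filter_upwards [eventually_gt_atTop i] with n hn
  exact mem_seen_initSeg.2 ⟨i, hn, hi⟩

theorem eventually_seen_eq {T : ℕ → Option ℕ} {F : Finset ℕ} (hT : content T = F) :
    ∀ᶠ n in atTop, seen (initSeg T n) = F := by
  filter_upwards [(eventually_all_finset F).2 fun x hx => eventually_mem_seen (hT.ge hx)]
    with n hn
  refine Finset.Subset.antisymm ?_ hn
  exact_mod_cast hT ▸ seen_initSeg_subset T n

/-! ### The learner for the family of intervals -/

/-- The only candidate for a `k` such that `F` is the `k`-th interval, where `A` stands for `Z`. -/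
noncomputable def guess (A : Set ℕ) (F : Finset ℕ) : ℕ := rank A (F.sup id) - 1

/-- The guess, withdrawn in favour of `0` if its class lies above some element of `F`. -/
noncomputable def cautiousGuess (A : Set ℕ) (F : Finset ℕ) : ℕ :=
  if ∀ y ∈ F, rank A (guess A F) ≤ rank A y then guess A F else 0

theorem cautiousGuess_intervalFamily {Z : Set ℕ} (hZ : Zᶜ.Infinite) {F : Finset ℕ} {k : ℕ}
    (hF : intervalFamily Z k = F) : cautiousGuess Z F = k := by
  have hmem : nonElement Z k ∈ F := by exact_mod_cast hF ▸ nonElement_mem_intervalFamily hZ k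
  have hiv : ∀ y ∈ F, y ∈ intervalFamily Z k := fun y hy => hF ▸ hy
  have hmax : rank Z (F.sup id) = k + 1 := by
    obtain ⟨x, hx, hsup⟩ := F.exists_mem_eq_sup ⟨_, hmem⟩ id
    refine le_antisymm (hsup ▸ (hiv x hx).2) ?_
    exact (lt_rank_iff hZ).2 (Finset.le_sup (f := id) hmem)
  have hguess : guess Z F = k := by rw [guess, hmax, Nat.add_sub_cancel]
  rw [cautiousGuess, hguess, if_pos fun y hy => (hiv y hy).1]

theorem eventually_cautiousGuess_eq {S : ℕ → Set ℕ} (hS : Monotone S) (F : Finset ℕ) :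
    ∀ᶠ s in atTop, cautiousGuess (S s) F = cautiousGuess (⋃ s, S s) F := by
  filter_upwards [eventually_rank_eq hS (F.sup id), eventually_rank_eq hS (guess (⋃ s, S s) F),
    (eventually_all_finset F).2 fun y _ => eventually_rank_eq hS y] with s hmax hrank hF
  have hguess : guess (S s) F = guess (⋃ s, S s) F := by rw [guess, guess, hmax]
  simp only [cautiousGuess, hguess, hrank]
  exact if_congr (forall₂_congr fun y hy => by rw [hF y hy]) rfl rfl

theorem cautiousGuess_eq_zero {Z A : Set ℕ} (hZ : Zᶜ.Infinite) (hA : A ⊆ Z) {F : Finset ℕ}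
    {x y : ℕ} (hx : x ∈ F) (hy : y ∈ F) (hxy : nonElement Z (nonElement Z (y + 1)) ≤ x) :
    cautiousGuess A F = 0 := by
  refine if_neg fun h => ?_
  have hguess : nonElement Z (y + 1) ≤ guess A F := by
    have hsup : nonElement Z (y + 1) < rank Z (F.sup id) :=
      (lt_rank_iff hZ).2 (hxy.trans (Finset.le_sup (f := id) hx))
    exact Nat.le_sub_one_of_lt (hsup.trans_le (rank_anti hA _))
  have hlt : y + 1 < rank A (guess A F) := ((lt_rank_iff hZ).2 hguess).trans_le (rank_anti hA _)
  exact (h y hy).not_gt ((rank_le A y).trans_lt hlt)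

/-- The learner for the family of intervals, where `e` computes indices of its members and `S`
enumerates `Z`. -/
noncomputable def intervalLearner (S : ℕ → Set ℕ) (e : ℕ → ℕ) (σ : List (Option ℕ)) : Option ℕ :=
  some (e (cautiousGuess (S σ.length) (seen σ)))

theorem primrec_intervalLearner {S : ℕ → Set ℕ} (hS : PrimrecRel fun s x => x ∈ S s) {e : ℕ → ℕ}
    (he : Primrec e) : Primrec (intervalLearner S e) := by
  have hr := primrec_rank hS
  have hseen : Primrec (List.reduceOption : List (Option ℕ) → List ℕ) :=
    Primrec.listFilterMap Primrec.id Primrec.snd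
  have hmax : Primrec fun σ => (seen σ).sup id :=
    (Primrec.list_foldr hseen (Primrec.const 0) (Primrec.nat_max.comp
      (Primrec.fst.comp Primrec.snd) (Primrec.snd.comp Primrec.snd)).to₂).of_eq fun σ =>
        List.foldr_sup_eq_sup_toFinset σ.reduceOption
  have hguess : Primrec fun σ : List (Option ℕ) => guess (S σ.length) (seen σ) :=
    Primrec.nat_sub.comp (hr.comp Primrec.list_length hmax) (Primrec.const 1)
  have hrel : PrimrecRel fun (y : ℕ) (p : ℕ × ℕ) => rank (S p.1) p.2 ≤ rank (S p.1) y :=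
    Primrec.nat_le.comp
      (hr.comp (Primrec.fst.comp Primrec.snd) (Primrec.snd.comp Primrec.snd))
      (hr.comp (Primrec.fst.comp Primrec.snd) Primrec.fst)
  have hbelow : PrimrecPred fun σ : List (Option ℕ) => ∀ y ∈ seen σ,
      rank (S σ.length) (guess (S σ.length) (seen σ)) ≤ rank (S σ.length) y :=
    (hrel.forall_mem_list.comp hseen (Primrec.list_length.pair hguess)).of_eq fun σ => by
      simp only [seen, List.mem_toFinset]
  exact Primrec.option_some.comp (he.comp (Primrec.ite hbelow hguess (Primrec.const 0)))

theorem intervalLearner_initSeg (S : ℕ → Set ℕ) (e : ℕ → ℕ) (T : ℕ → Option ℕ) (n : ℕ) :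
    intervalLearner S e (initSeg T n) = some (e (cautiousGuess (S n) (seen (initSeg T n)))) := by
  simp [intervalLearner, initSeg]

theorem eventually_intervalLearner_of_finite {S : ℕ → Set ℕ} (hS : Monotone S) (e : ℕ → ℕ)
    {T : ℕ → Option ℕ} {F : Finset ℕ} (hT : content T = F) :
    ∀ᶠ n in atTop,
      intervalLearner S e (initSeg T n) = some (e (cautiousGuess (⋃ s, S s) F)) := by
  filter_upwards [eventually_seen_eq hT, eventually_cautiousGuess_eq hS F] with n hseen hguess
  rw [intervalLearner_initSeg, hseen, hguess]

theorem eventually_intervalLearner_of_infinite {S : ℕ → Set ℕ} (hS : (⋃ s, S s)ᶜ.Infinite)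
    (e : ℕ → ℕ) {T : ℕ → Option ℕ} (hT : (content T).Infinite) :
    ∀ᶠ n in atTop, intervalLearner S e (initSeg T n) = some (e 0) := by
  obtain ⟨y, hy⟩ := hT.nonempty
  obtain ⟨x, hx, hlt⟩ := hT.exists_gt (nonElement (⋃ s, S s) (nonElement (⋃ s, S s) (y + 1)))
  filter_upwards [eventually_mem_seen hx, eventually_mem_seen hy] with n hxn hyn
  rw [intervalLearner_initSeg,
    cautiousGuess_eq_zero hS (Set.subset_iUnion S n) hxn hyn hlt.le]

theorem confLearnable_intervalFamily {Z : Set ℕ} (hre : REPred fun x => x ∈ Z)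
    (hZ : Zᶜ.Infinite) (h0 : 0 ∉ Z) :
    ConfLearnable (zeta Z) (Set.range (intervalFamily Z)) := by
  obtain ⟨e, hep, he⟩ := (isFamily_intervalFamily hre hZ h0).exists_primrec_index
    (isPositive_zeta hre hZ h0).equivalence.refl
  obtain ⟨S, hSp, hS, rfl⟩ := exists_primrec_stages hre
  refine ⟨intervalLearner S e, (primrec_intervalLearner hSp hep).to_comp, ?_, fun T => ?_⟩
  · rintro _ ⟨k, rfl⟩ T hT
    obtain ⟨F, hF⟩ := (intervalFamily_finite hZ k).exists_finset_coe
    obtain ⟨n, hn⟩ :=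
      eventually_atTop.1 (eventually_intervalLearner_of_finite hS e (hT.trans hF.symm))
    rw [cautiousGuess_intervalFamily hZ hF.symm] at hn
    exact ⟨n, e k, he k, hn⟩
  · suffices h : ∃ i, ∀ᶠ n in atTop, intervalLearner S e (initSeg T n) = some i by
      obtain ⟨i, hi⟩ := h
      obtain ⟨n, hn⟩ := eventually_atTop.1 hi
      exact ⟨n, i, hn⟩
    by_cases hT : (content T).Finite
    · obtain ⟨F, hF⟩ := hT.exists_finset_coe
      exact ⟨_, eventually_intervalLearner_of_finite hS e hF.symm⟩
    · exact ⟨_, eventually_intervalLearner_of_infinite hZ e hT⟩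

/-! ### Finite learning -/

/-- The text which follows `T` before position `n` and starts `T'` from there on. -/
def prolong (T : ℕ → Option ℕ) (n : ℕ) (T' : ℕ → Option ℕ) (i : ℕ) : Option ℕ :=
  if i < n then T i else T' (i - n)

theorem initSeg_prolong (T : ℕ → Option ℕ) (n : ℕ) (T' : ℕ → Option ℕ) :
    initSeg (prolong T n T') n = initSeg T n :=
  List.map_congr_left fun _ hi => if_pos (List.mem_range.1 hi)

theorem content_prolong {T : ℕ → Option ℕ} {n : ℕ} {T' : ℕ → Option ℕ}
    (h : ↑(seen (initSeg T n)) ⊆ content T') : content (prolong T n T') = content T' := by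
  ext x
  constructor
  · rintro ⟨i, hi⟩
    rw [prolong] at hi
    split_ifs at hi with hin
    · exact h (mem_seen_initSeg.2 ⟨i, hin, hi⟩)
    · exact ⟨_, hi⟩
  · rintro ⟨i, hi⟩
    exact ⟨n + i, by simp [prolong, hi]⟩

theorem exists_primrec_texts {B : ℕ → Set ℕ} (hB : REPred fun p : ℕ × ℕ => p.2 ∈ B p.1) :
    ∃ T : ℕ → ℕ → Option ℕ, Primrec₂ T ∧ (∀ k, content (T k) = B k) ∧
      ∀ k i x, T k i = some x → x ≤ i := by
  classical
  obtain ⟨S, hSp, -, hS⟩ := exists_primrec_stages (A := {p : ℕ × ℕ | p.2 ∈ B p.1}) hB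
  let T (k i : ℕ) : Option ℕ := if (k, i.unpair.2) ∈ S i.unpair.1 then some i.unpair.2 else none
  have hT : ∀ {k i x}, T k i = some x ↔ (k, x) ∈ S i.unpair.1 ∧ i.unpair.2 = x := by
    intro k i x
    simp only [T, Option.ite_none_right_eq_some, Option.some_inj]
    exact and_congr_left fun h => by rw [h]
  refine ⟨T, ?_, fun k => ?_, fun k i x h => (hT.1 h).2 ▸ Nat.unpair_right_le i⟩
  · have hu : Primrec fun p : ℕ × ℕ => p.2.unpair := Primrec.unpair.comp Primrec.snd
    have h1 := Primrec.fst.comp hu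
    have h2 := Primrec.snd.comp hu
    exact Primrec.ite (hSp.comp h1 (Primrec.fst.pair h2)) (Primrec.option_some.comp h2)
      (Primrec.const none)
  · ext x
    have hmem : x ∈ B k ↔ ∃ s, (k, x) ∈ S s := by
      rw [← Set.mem_iUnion, hS, Set.mem_ofPred_eq]
    rw [hmem]
    exact ⟨fun ⟨i, hi⟩ => ⟨_, (hT.1 hi).1⟩,
      fun ⟨s, hs⟩ => ⟨Nat.pair s x, hT.2 (by simpa using hs)⟩⟩

section FinLearns

variable {H : ℕ → Set ℕ} {M : List (Option ℕ) → Option ℕ}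

theorem FinLearns.hypothesis_eq {C : Set (Set ℕ)} (hM : FinLearns H M C) {T : ℕ → Option ℕ}
    (hT : content T ∈ C) {n e : ℕ} (he : M (initSeg T n) = some e) : H e = content T := by
  obtain ⟨m, e', he', hbefore, hafter⟩ := hM _ hT T rfl
  have hmn : m ≤ n := not_lt.1 fun hlt => by simp [hbefore n hlt] at he
  rwa [← Option.some_inj.1 ((hafter n hmn).symm.trans he)]

theorem FinLearns.content_eq {C : Set (Set ℕ)} (hM : FinLearns H M C) {T T' : ℕ → Option ℕ}
    (hT : content T ∈ C) (hT' : content T' ∈ C) {n : ℕ} (hn : (M (initSeg T n)).isSome)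
    (h : ↑(seen (initSeg T n)) ⊆ content T') : content T = content T' := by
  obtain ⟨e, he⟩ := Option.isSome_iff_exists.1 hn
  have hc := content_prolong h
  have he' : M (initSeg (prolong T n T') n) = some e := by rwa [initSeg_prolong]
  rw [← hM.hypothesis_eq hT he, hM.hypothesis_eq (hc ▸ hT') he', hc]

theorem exists_computable_commitTime (hM : Computable M) {T : ℕ → ℕ → Option ℕ} (hT : Primrec₂ T)
    (h : ∀ k, ∃ n, (M (initSeg (T k) n)).isSome) :
    ∃ N : ℕ → ℕ, Computable N ∧ ∀ k, (M (initSeg (T k) (N k))).isSome := by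
  have hseg : Primrec fun p : ℕ × ℕ => initSeg (T p.1) p.2 :=
    Primrec.list_map (Primrec.list_range.comp Primrec.snd)
      (hT.comp (Primrec.fst.comp Primrec.fst) Primrec.snd)
  have hcomp : ComputablePred fun p : ℕ × ℕ => (M (initSeg (T p.1) p.2)).isSome = true :=
    Computable.computablePred <| by
      simpa using Primrec.option_isSome.to_comp.comp (hM.comp hseg.to_comp)
  exact ⟨_, Computable.find (P := fun k n => (M (initSeg (T k) n)).isSome = true) hcomp h,
    fun k => Nat.find_spec (h k)⟩

theorem FinLearns.exists_definite_samples {B : ℕ → Set ℕ} (hM : FinLearns H M (Set.range B))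
    (hMc : Computable M) (hinj : Function.Injective B)
    (hB : REPred fun p : ℕ × ℕ => p.2 ∈ B p.1) :
    ∃ (N : ℕ → ℕ) (D : ℕ → Finset ℕ), Computable N ∧ (∀ k, ∀ x ∈ D k, x < N k) ∧
      (∀ k, ↑(D k) ⊆ B k) ∧ ∀ j k, ↑(D k) ⊆ B j → j = k := by
  obtain ⟨T, hTp, hT, hTle⟩ := exists_primrec_texts hB
  have hTB : ∀ k, content (T k) ∈ Set.range B := fun k => ⟨k, (hT k).symm⟩
  obtain ⟨N, hN, hsome⟩ := exists_computable_commitTime hMc hTp fun k => by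
    obtain ⟨n, e, -, -, h⟩ := hM _ (hTB k) (T k) rfl
    exact ⟨n, by simp [h n le_rfl]⟩
  refine ⟨N, fun k => seen (initSeg (T k) (N k)), hN, fun k x hx => ?_,
    fun k => hT k ▸ seen_initSeg_subset _ _, fun j k hjk => hinj ?_⟩
  · obtain ⟨i, hi, hix⟩ := mem_seen_initSeg.1 hx
    exact (hTle k i x hix).trans_lt hi
  · rw [← hT j] at hjk
    rw [← hT j, ← hT k, hM.content_eq (hTB k) (hTB j) (hsome k) hjk]

end FinLearns

theorem exists_ne_subset_of_lt_nonElement {Z : Set ℕ} (hZ : Zᶜ.Infinite) (h0 : 0 ∉ Z)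
    {B : ℕ → Set ℕ} {D : ℕ → Finset ℕ} (hB : ∀ k, IsClosedUnder (zeta Z) (B k))
    (hD : ∀ k, ↑(D k) ⊆ B k) {n : ℕ} (hn : ∀ k ≤ 2 ^ n, ∀ x ∈ D k, x < nonElement Z n) :
    ∃ j k, j ≠ k ∧ ↑(D k) ⊆ B j := by
  have hranks : ∀ k ≤ 2 ^ n, (D k).image (rank Z) ⊆ Finset.Icc 1 n := fun k hk => by
    refine Finset.image_subset_iff.2 fun x hx => Finset.mem_Icc.2 ⟨rank_pos h0 x, ?_⟩
    exact not_lt.1 fun h => (hn k hk x hx).not_ge ((lt_rank_iff hZ).1 h)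
  obtain ⟨j, -, k, -, hjk, himage⟩ := Finset.exists_ne_map_eq_of_card_lt_of_maps_to
    (s := Finset.range (2 ^ n + 1)) (t := (Finset.Icc 1 n).powerset)
    (f := fun k => (D k).image (rank Z)) (by simp) fun k hk =>
      Finset.mem_powerset.2 (hranks k (Nat.lt_succ_iff.1 (Finset.mem_range.1 hk)))
  refine ⟨j, k, hjk, fun x hx => ?_⟩
  obtain ⟨y, hy, hyx⟩ := Finset.mem_image.1 (himage ▸ Finset.mem_image_of_mem (rank Z) hx)
  exact hB j y x ((zeta_iff_rank_eq hZ h0).2 hyx) (hD j hy)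

theorem computable_sum_range {f : ℕ → ℕ} (hf : Computable f) :
    Computable fun n => ∑ k ∈ Finset.range n, f k := by
  have h : Computable fun n : ℕ => (Nat.rec 0 (fun k acc => acc + f k) n : ℕ) :=
    Computable.nat_rec Computable.id (Computable.const 0)
      (Primrec.nat_add.to_comp.comp (Computable.snd.comp Computable.snd)
        (hf.comp (Computable.fst.comp Computable.snd))).to₂
  refine h.of_eq fun n => ?_
  induction n with
  | zero => rfl
  | succ n ih => rw [Finset.sum_range_succ, ← ih]

theorem primrec_const_pow (b : ℕ) : Primrec fun n : ℕ => b ^ n := by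
  have h : Primrec fun n : ℕ => (Nat.rec 1 (fun _ acc => acc * b) n : ℕ) :=
    Primrec.nat_rec₁ 1 (Primrec.nat_mul.comp Primrec.snd (Primrec.const b))
  refine h.of_eq fun n => ?_
  induction n with
  | zero => rfl
  | succ n ih => rw [pow_succ, ← ih]

/-- `Z` is hypersimple: r.e., coinfinite, and the ascending enumeration of its complement is not
majorized by a recursive function. -/
structure IsHypersimple (Z : Set ℕ) : Prop where
  re : REPred (fun x : ℕ => x ∈ Z)
  coinfinite : Zᶜ.Infinite
  not_majorized : ∀ f : ℕ → ℕ, Computable f → ∃ n, f n < nonElement Z n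

theorem IsDenseSimple.isHypersimple {Z : Set ℕ} (hZ : IsDenseSimple Z) : IsHypersimple Z where
  re := hZ.re
  coinfinite := hZ.coinfinite
  not_majorized f hf := (hZ.dominates f hf).imp fun N hN => hN N le_rfl

theorem IsHypersimple.not_finLearnable {Z : Set ℕ} (hZ : IsHypersimple Z) (h0 : 0 ∉ Z)
    {B : ℕ → Set ℕ} (hB : IsFamily (zeta Z) B) : ¬ FinLearnable (zeta Z) (Set.range B) := by
  rintro ⟨M, hMc, hM⟩
  obtain ⟨N, D, hN, hDN, hDB, hdef⟩ :=
    hM.exists_definite_samples hMc hB.injective hB.uniformly_re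
  obtain ⟨n, hn⟩ := hZ.not_majorized _ ((computable_sum_range hN).comp
    (Primrec.succ.comp (primrec_const_pow 2)).to_comp)
  have hDn : ∀ k ≤ 2 ^ n, ∀ x ∈ D k, x < nonElement Z n := fun k hk x hx => by
    have hNk : N k ≤ ∑ i ∈ Finset.range (2 ^ n + 1), N i :=
      Finset.single_le_sum (fun _ _ => Nat.zero_le _) (Finset.mem_range.2 (Nat.lt_succ_of_le hk))
    exact (hDN k x hx).trans (hNk.trans_lt hn)
  obtain ⟨j, k, hjk, hsub⟩ :=
    exists_ne_subset_of_lt_nonElement hZ.coinfinite h0 hB.closed hDB hDn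
  exact hjk (hdef j k hsub)

end EtaLearning

open EtaLearning in
theorem theorem6p3_general (Z : Set ℕ) (hZ : IsHypersimple Z) (h0 : 0 ∉ Z) :
    IsPositive (zeta Z) ∧
    (∃ B : ℕ → Set ℕ, IsFamily (zeta Z) B ∧ ConfLearnable (zeta Z) (Set.range B)) ∧
    (∀ B : ℕ → Set ℕ, IsFamily (zeta Z) B → ¬ FinLearnable (zeta Z) (Set.range B)) :=
  ⟨isPositive_zeta hZ.re hZ.coinfinite h0,
    ⟨intervalFamily Z, isFamily_intervalFamily hZ.re hZ.coinfinite h0,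
      confLearnable_intervalFamily hZ.re hZ.coinfinite h0⟩,
    fun _ hB => hZ.not_finLearnable h0 hB⟩

open EtaLearning in
theorem theorem6p3 (Z : Set ℕ) (hZ : IsDenseSimple Z) (h0 : 0 ∉ Z) :
    IsPositive (zeta Z) ∧
    (∃ B : ℕ → Set ℕ, IsFamily (zeta Z) B ∧ ConfLearnable (zeta Z) (Set.range B)) ∧
    (∀ B : ℕ → Set ℕ, IsFamily (zeta Z) B → ¬ FinLearnable (zeta Z) (Set.range B)) :=
  theorem6p3_general Z hZ.isHypersimple h0
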